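/- A tiling of $\mathbb R^2$ is a countable family $\mathcal T=\{T_n\}_{n\in\mathbb N}$ of closed connected subsets of $\mathbb R^2$ (the tiles) with $\bigcup_n T_n=\mathbb R^2$ and $\operatorname{int}T_i\cap\operatorname{int}T_j=\emptyset$ for $i\ne j$. A vertex is a point lying in at least three tiles; an edge is a connected component of a set $E_{i,j}=\{u\in T_i\cap T_j : u\text{ is not a vertex}\}$ with $i\neq j$; a face is the interior of a tile. Assume moreover that $\mathcal T$ is locally finite, that every tile is homeomorphic to the closed unit disk, that every edge is homeomorphic to $(0,1)$, and that the intersection of any two different tiles that meet is a disjoint union of finitely many vertices and edges. Let $\mathcal V_{\mathcal T},\mathcal E_{\mathcal T},\mathcal F_{\mathcal T}$ be the sets of vertices, edges and faces, and let the digital version $\mathcal D_{\mathcal T}=\mathcal F_{\mathcal T}\cup\mathcal E_{\mathcal T}\cup\mathcal V_{\mathcal T}$ carry the quotient topology induced by the map $q:\mathbb R^2\to\mathcal D_{\mathcal T}$ that sends each point to the vertex, edge or face in which it lies. For a vertex $x$ let $\mathcal E_x$ be the set of edges whose closure contains $x$; for a vertex or an edge $x$ let $\mathcal F_x$ be the set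 of the interiors of the tiles that contain $x$. **Theorem.** For every such tiling $\mathcal T$, the space $\mathcal D_{\mathcal T}$ is an Alexandrov space, that is, arbitrary intersections of open sets are open. Moreover, every $x\in\mathcal D_{\mathcal T}$ has a smallest neighbourhood $N(x)$, given by $$N(x)=\begin{cases}\{x\}\cup\mathcal E_x\cup\mathcal F_x & \text{if } x\in\mathcal V_{\mathcal T},\\ \{x\}\cup\mathcal F_x & \text{if } x\in\mathcal E_{\mathcal T}, \text{ where } \mathcal F_x \text{ has exactly two elements},\\ \{x\} & \text{if } x\in\mathcal F_{\mathcal T}.\end{cases}$$ -/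

import Mathlib

open Set Topology

/-- The Euclidean plane `ℝ²`. -/
abbrev Plane : Type := EuclideanSpace ℝ (Fin 2)

/-- A point that belongs to three or more members of the family `T`. -/
def IsVertexPoint (T : ℕ → Set Plane) (u : Plane) : Prop :=
  ∃ i j k : ℕ, i ≠ j ∧ i ≠ k ∧ j ≠ k ∧ u ∈ T i ∧ u ∈ T j ∧ u ∈ T k

/-- The set `E_{i,j}` of the common points of `T i` and `T j` that are not vertices. -/
def edgeLocus (T : ℕ → Set Plane) (i j : ℕ) : Set Plane :=
  {u | u ∈ T i ∩ T j ∧ ¬ IsVertexPoint T u}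

/-- A vertex, regarded as a one-point subset of the plane. -/
def IsVertex (T : ℕ → Set Plane) (c : Set Plane) : Prop :=
  ∃ u, IsVertexPoint T u ∧ c = {u}

/-- An edge: a connected component of some `E_{i,j}` with `i ≠ j`. -/
def IsEdge (T : ℕ → Set Plane) (c : Set Plane) : Prop :=
  ∃ i j : ℕ, i ≠ j ∧ ∃ u ∈ edgeLocus T i j, c = connectedComponentIn (edgeLocus T i j) u

/-- A face: the interior of a tile. -/
def IsFace (T : ℕ → Set Plane) (c : Set Plane) : Prop :=
  ∃ n : ℕ, c = interior (T n)

/-- A tiling of the plane: a countable locally finite cover by closed topological disks with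
pairwise disjoint interiors, whose edges are open arcs, and such that two different tiles that
meet do so in a disjoint union of finitely many vertices and edges. -/
structure Tiling where
  /-- The tiles. -/
  tile : ℕ → Set Plane
  isClosed_tile : ∀ n, IsClosed (tile n)
  isConnected_tile : ∀ n, IsConnected (tile n)
  iUnion_tile : ⋃ n, tile n = univ
  interior_disjoint : ∀ i j, i ≠ j → interior (tile i) ∩ interior (tile j) = ∅
  locallyFinite_tile : LocallyFinite tile
  tile_homeo : ∀ n, Nonempty (tile n ≃ₜ Metric.closedBall (0 : Plane) 1)
  edge_homeo : ∀ e, IsEdge tile e → Nonempty (e ≃ₜ Ioo (0 : ℝ) 1)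
  inter_tile : ∀ i j, i ≠ j → (tile i ∩ tile j).Nonempty →
    ∃ C : Set (Set Plane), C.Finite ∧ (∀ c ∈ C, IsVertex tile c ∨ IsEdge tile c) ∧
      C.PairwiseDisjoint id ∧ ⋃₀ C = tile i ∩ tile j

namespace Tiling

/-- The underlying set of the digital version of `T`: all faces, edges and vertices. -/
def DigitalVersion (T : Tiling) : Type :=
  {c : Set Plane // IsFace T.tile c ∨ IsEdge T.tile c ∨ IsVertex T.tile c}

/-- A point that is neither a vertex nor on an edge lies in a face. -/
theorem exists_face (T : Tiling) (u : Plane) (hv : ¬ IsVertexPoint T.tile u)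
    (he : ¬ ∃ e, IsEdge T.tile e ∧ u ∈ e) : ∃ f, IsFace T.tile f ∧ u ∈ f := by
  obtain ⟨n, hn⟩ := mem_iUnion.1 (T.iUnion_tile ▸ mem_univ u)
  refine ⟨_, ⟨n, rfl⟩, ?_⟩
  have huniq : ∀ m, m ≠ n → u ∉ T.tile m := fun m hm hum =>
    he ⟨_, ⟨m, n, hm, u, ⟨⟨hum, hn⟩, hv⟩, rfl⟩, mem_connectedComponentIn ⟨⟨hum, hn⟩, hv⟩⟩
  have hclosed : IsClosed (⋃ m : {m // m ≠ n}, T.tile m) :=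
    (T.locallyFinite_tile.comp_injective Subtype.val_injective).isClosed_iUnion
      fun m => T.isClosed_tile m
  refine mem_interior.2 ⟨_, ?_, hclosed.isOpen_compl, ?_⟩
  · intro x hx
    obtain ⟨m, hm⟩ := mem_iUnion.1 (T.iUnion_tile ▸ mem_univ x)
    by_cases h : m = n
    · exact h ▸ hm
    · exact absurd (mem_iUnion.2 ⟨⟨m, h⟩, hm⟩) hx
  · intro hu
    obtain ⟨⟨m, h⟩, hm⟩ := mem_iUnion.1 hu
    exact huniq m h hm

open Classical in
/-- The surjection `q` from the plane to the digital version: it sends a point to the vertex,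
edge or face in which it lies. -/
noncomputable def q (T : Tiling) (u : Plane) : T.DigitalVersion :=
  if hv : IsVertexPoint T.tile u then ⟨{u}, Or.inr (Or.inr ⟨u, hv, rfl⟩)⟩
  else if he : ∃ e, IsEdge T.tile e ∧ u ∈ e then
    ⟨he.choose, Or.inr (Or.inl he.choose_spec.1)⟩
  else
    ⟨(T.exists_face u hv he).choose, Or.inl (T.exists_face u hv he).choose_spec.1⟩

/-- The digital version carries the quotient topology induced by `q`. -/
noncomputable instance instTopologicalSpaceDigitalVersion (T : Tiling) : 
    TopologicalSpace T.DigitalVersion :=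
  TopologicalSpace.coinduced T.q inferInstance

/-- `𝒱_T`: the vertices, as elements of the digital version. -/
def vertices (T : Tiling) : Set T.DigitalVersion := {x | IsVertex T.tile x.1}

/-- `ℰ_T`: the edges, as elements of the digital version. -/
def edges (T : Tiling) : Set T.DigitalVersion := {x | IsEdge T.tile x.1}

/-- `ℱ_T`: the faces, as elements of the digital version. -/
def faces (T : Tiling) : Set T.DigitalVersion := {x | IsFace T.tile x.1}

/-- `ℰ_x`, for a vertex `x`: the edges that converge in `x`, that is, have `x` in their closure. -/
def edgesOf (T : Tiling) (x : T.DigitalVersion) : Set T.DigitalVersion :=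
  {e | e ∈ T.edges ∧ x.1 ⊆ closure e.1}

/-- `ℱ_x`, for a vertex or an edge `x`: the faces of the tiles that contain `x`. -/
def facesOf (T : Tiling) (x : T.DigitalVersion) : Set T.DigitalVersion :=
  {f | ∃ n : ℕ, f.1 = interior (T.tile n) ∧ x.1 ⊆ T.tile n}

end Tiling

/-!
The faces, edges and vertices of a tiling ("cells") partition the plane, so `T.q u = c` just says
that `u` lies in the cell `c`. The smallest neighbourhood of a cell `x` is its star, the set of
the cells `d` with `x ⊆ closure d`, because of two facts.

* The cells form a locally finite family (`locallyFinite_cells`), since the tiles do and two tiles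
  share only finitely many edges and vertices. Hence points near `u` lie only in cells whose
  closures contain `u`.
* If the closure of a cell `d` meets a cell `c`, it contains `c`
  (`subset_closure_of_mem_closure`). Hence the relation "`x ⊆ closure d`" can be tested at any
  point of `x`, and stars are open.

That cells are nonempty and pairwise disjoint, and the second fact, rest on every tile being the
closure of its interior (`subset_closure_interior`). This does not need invariance of domain: were
some nonempty `T n ∩ V`, with `V` open, without interior points, the other tiles would cover it,
so it would be covered by countably many points and open arcs. By Baire's theorem one of these
would contain a topological copy of the plane, and so the plane would inject continuously into the
line, which fails because removing a point does not disconnect the plane. The stars are then read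
off cell by cell.
-/

/-! ### Dimension of the plane -/

theorem Plane.not_injective_of_continuous {f : Plane → ℝ} (hf : Continuous f) :
    ¬ Function.Injective f := by
  intro hinj
  have hrank : 1 < Module.rank ℝ Plane := by
    rw [← Module.finrank_eq_rank]
    simp
  have key : ∀ a b c : Plane, f a < f b → f b < f c → False := by
    intro a b c hab hbc
    have hconn := (isConnected_compl_singleton_of_one_lt_rank hrank b).isPreconnected.image f
      hf.continuousOn
    have ha : f a ∈ f '' {b}ᶜ := ⟨a, fun h => hab.ne (congrArg f h), rfl⟩
    have hc : f c ∈ f '' {b}ᶜ := ⟨c, fun h => hbc.ne' (congrArg f h), rfl⟩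
    obtain ⟨p, hp, hpb⟩ := hconn.ordConnected.out ha hc ⟨hab.le, hbc.le⟩
    exact hp (hinj hpb)
  have h01 : (!₂[0, 0] : Plane) ≠ !₂[1, 0] := fun h => by simpa using congrArg (fun v => v 0) h
  have h02 : (!₂[0, 0] : Plane) ≠ !₂[0, 1] := fun h => by simpa using congrArg (fun v => v 1) h
  have h12 : (!₂[1, 0] : Plane) ≠ !₂[0, 1] := fun h => by simpa using congrArg (fun v => v 0) h
  rcases lt_or_gt_of_ne (hinj.ne h01) with h | h <;>
    rcases lt_or_gt_of_ne (hinj.ne h02) with h' | h' <;>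
    rcases lt_or_gt_of_ne (hinj.ne h12) with h'' | h'' <;>
    first
      | exact key _ _ _ h h''
      | exact key _ _ _ h'' h
      | exact key _ _ _ h' h''
      | exact key _ _ _ h'' h'
      | exact key _ _ _ h h'
      | exact key _ _ _ h' h

theorem Plane.exists_continuous_injective_mem {W : Set Plane} (hW : IsOpen W) (hne : W.Nonempty) :
    ∃ e : Plane → Plane, Continuous e ∧ Function.Injective e ∧ ∀ p, e p ∈ W := by
  obtain ⟨w, hw⟩ := hne
  obtain ⟨r, hr, hball⟩ := Metric.isOpen_iff.1 hW w hw
  let φ := OpenPartialHomeomorph.univBall w r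
  have hs : φ.source = univ := OpenPartialHomeomorph.univBall_source w r
  refine ⟨φ, OpenPartialHomeomorph.continuous_univBall w r, ?_, fun p => hball ?_⟩
  · rw [← injOn_univ, ← hs]
    exact φ.injOn
  · rw [← OpenPartialHomeomorph.univBall_target w hr]
    exact φ.map_source (hs ▸ mem_univ p)

/-- A plane set that is a countable union of σ-compact sets injecting continuously into the line
contains no topological copy of the plane, by Baire's theorem. -/
theorem Plane.false_of_injective_of_countable_cover {C : Set (Set Plane)} (hC : C.Countable)
    (hσ : ∀ c ∈ C, IsSigmaCompact c)
    (hline : ∀ c ∈ C, ∃ f : c → ℝ, Continuous f ∧ Function.Injective f)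
    {G : Plane → Plane} (hG : Continuous G) (hinj : Function.Injective G)
    (hcov : ∀ p, ∃ c ∈ C, G p ∈ c) : False := by
  have : Countable C := hC.to_subtype
  choose K hK hKc using fun c : C => hσ c.1 c.2
  have huniv : ⋃ i : C × ℕ, G ⁻¹' K i.1 i.2 = univ := by
    refine eq_univ_of_forall fun p => ?_
    obtain ⟨c, hc, hp⟩ := hcov p
    obtain ⟨k, hk⟩ := mem_iUnion.1 ((hKc ⟨c, hc⟩).symm ▸ hp : G p ∈ ⋃ k, K ⟨c, hc⟩ k)
    exact mem_iUnion.2 ⟨(⟨c, hc⟩, k), hk⟩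
  obtain ⟨⟨c, k⟩, hne⟩ := nonempty_interior_of_iUnion_of_closed
    (fun i : C × ℕ => (hK i.1 i.2).isClosed.preimage hG) huniv
  obtain ⟨e, he, heinj, hmem⟩ := Plane.exists_continuous_injective_mem isOpen_interior hne
  obtain ⟨f, hf, hfinj⟩ := hline c.1 c.2
  have hin : ∀ p, G (e p) ∈ c.1 := fun p => by
    have hp : e p ∈ G ⁻¹' K c k := interior_subset (hmem p)
    rw [← hKc c]
    exact mem_iUnion.2 ⟨k, hp⟩
  exact Plane.not_injective_of_continuous
    (hf.comp ((hG.comp he).subtype_mk hin)) fun p p' h =>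
      heinj (hinj (congrArg Subtype.val (hfinj h)))

namespace Tiling

/-! ### Edges and vertices -/

variable {T : Tiling}

theorem eq_or_eq_of_not_isVertexPoint {u : Plane} (hv : ¬ IsVertexPoint T.tile u) {i j k : ℕ}
    (hij : i ≠ j) (hi : u ∈ T.tile i) (hj : u ∈ T.tile j) (hk : u ∈ T.tile k) :
    k = i ∨ k = j := by
  by_contra! h
  exact hv ⟨i, j, k, hij, h.1.symm, h.2.symm, hi, hj, hk⟩

theorem edgeLocus_comm (i j : ℕ) : edgeLocus T.tile i j = edgeLocus T.tile j i := by
  simp only [edgeLocus, inter_comm]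

theorem edge_not_isVertexPoint {e : Set Plane} (he : IsEdge T.tile e) {u : Plane} (hu : u ∈ e) :
    ¬ IsVertexPoint T.tile u := by
  obtain ⟨i, j, -, w, -, rfl⟩ := he
  exact (connectedComponentIn_subset _ _ hu).2

theorem edge_eq_connectedComponentIn {e : Set Plane} (he : IsEdge T.tile e) {u : Plane}
    (hu : u ∈ e) {i j : ℕ} (hij : i ≠ j) (hi : u ∈ T.tile i) (hj : u ∈ T.tile j) :
    e = connectedComponentIn (edgeLocus T.tile i j) u := by
  obtain ⟨k, l, hkl, w, -, rfl⟩ := he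
  obtain ⟨⟨hk, hl⟩, hv⟩ := connectedComponentIn_subset _ _ hu
  rw [connectedComponentIn_eq hu]
  rcases eq_or_eq_of_not_isVertexPoint hv hij hi hj hk with rfl | rfl <;>
    rcases eq_or_eq_of_not_isVertexPoint hv hij hi hj hl with rfl | rfl
  · exact absurd rfl hkl
  · rfl
  · rw [edgeLocus_comm]
  · exact absurd rfl hkl

theorem edge_nonempty {e : Set Plane} (he : IsEdge T.tile e) : e.Nonempty := by
  obtain ⟨i, j, -, w, hw, rfl⟩ := he
  exact ⟨w, mem_connectedComponentIn hw⟩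

theorem edge_exists_tiles {e : Set Plane} (he : IsEdge T.tile e) :
    ∃ i j, i ≠ j ∧ e ⊆ T.tile i ∧ e ⊆ T.tile j := by
  obtain ⟨i, j, hij, w, -, rfl⟩ := he
  exact ⟨i, j, hij, fun u hu => (connectedComponentIn_subset _ _ hu).1.1,
    fun u hu => (connectedComponentIn_subset _ _ hu).1.2⟩

theorem edge_subset_tile {e : Set Plane} (he : IsEdge T.tile e) {u : Plane} (hu : u ∈ e) {n : ℕ}
    (hn : u ∈ T.tile n) : e ⊆ T.tile n := by
  obtain ⟨i, j, hij, hi, hj⟩ := edge_exists_tiles he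
  rcases eq_or_eq_of_not_isVertexPoint (edge_not_isVertexPoint he hu) hij (hi hu) (hj hu) hn
    with rfl | rfl
  · exact hi
  · exact hj

theorem edge_unique {c d : Set Plane} (hc : IsEdge T.tile c) (hd : IsEdge T.tile d) {u : Plane}
    (huc : u ∈ c) (hud : u ∈ d) : c = d := by
  obtain ⟨i, j, hij, hi, hj⟩ := edge_exists_tiles hc
  rw [edge_eq_connectedComponentIn hc huc hij (hi huc) (hj huc),
    edge_eq_connectedComponentIn hd hud hij (hi huc) (hj huc)]

theorem edge_or_vertex_unique {c d : Set Plane} (hc : IsEdge T.tile c ∨ IsVertex T.tile c)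
    (hd : IsEdge T.tile d ∨ IsVertex T.tile d) {u : Plane} (huc : u ∈ c) (hud : u ∈ d) :
    c = d := by
  rcases hc with hc | ⟨v, hv, rfl⟩ <;> rcases hd with hd | ⟨w, hw, rfl⟩
  · exact edge_unique hc hd huc hud
  · exact absurd (mem_singleton_iff.1 hud ▸ hw) (edge_not_isVertexPoint hc huc)
  · exact absurd (mem_singleton_iff.1 huc ▸ hv) (edge_not_isVertexPoint hd hud)
  · rw [← mem_singleton_iff.1 huc, ← mem_singleton_iff.1 hud]

/-- An edge is closed relative to the set of the non-vertices: adding to it a limit point in the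
same `edgeLocus` keeps it connected. -/
theorem mem_edge_of_mem_closure {e : Set Plane} (he : IsEdge T.tile e) {u : Plane}
    (hu : u ∈ closure e) (hv : ¬ IsVertexPoint T.tile u) : u ∈ e := by
  obtain ⟨i, j, -, w, hw, rfl⟩ := he
  have hsub := connectedComponentIn_subset (edgeLocus T.tile i j) w
  have hcl : closure (connectedComponentIn (edgeLocus T.tile i j) w) ⊆ T.tile i ∩ T.tile j :=
    closure_minimal (hsub.trans fun _ h => h.1) ((T.isClosed_tile i).inter (T.isClosed_tile j))
  have hconn : IsPreconnected (insert u (connectedComponentIn (edgeLocus T.tile i j) w)) :=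
    isPreconnected_connectedComponentIn.subset_closure (subset_insert _ _)
      (insert_subset hu subset_closure)
  exact hconn.subset_connectedComponentIn (mem_insert_of_mem _ (mem_connectedComponentIn hw))
    (insert_subset (show u ∈ edgeLocus T.tile i j from ⟨hcl hu, hv⟩) hsub) (mem_insert _ _)

theorem isSigmaCompact_edge {e : Set Plane} (he : IsEdge T.tile e) : IsSigmaCompact e := by
  obtain ⟨φ⟩ := T.edge_homeo e he
  have : LocallyCompactSpace (Ioo (0 : ℝ) 1) := isOpen_Ioo.locallyCompactSpace
  rw [isSigmaCompact_iff_sigmaCompactSpace]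
  exact φ.isClosedEmbedding.sigmaCompactSpace

theorem exists_continuous_injective_edge {e : Set Plane} (he : IsEdge T.tile e) :
    ∃ f : e → ℝ, Continuous f ∧ Function.Injective f := by
  obtain ⟨φ⟩ := T.edge_homeo e he
  exact ⟨fun p => φ p, continuous_subtype_val.comp φ.continuous,
    Subtype.val_injective.comp φ.injective⟩

/-- Only finitely many edges and vertices meet the intersection of two different tiles. -/
theorem finite_edges_vertices_inter (T : Tiling) {i j : ℕ} (hij : i ≠ j) :
    {c | (IsEdge T.tile c ∨ IsVertex T.tile c) ∧ (c ∩ (T.tile i ∩ T.tile j)).Nonempty}.Finite := by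
  rcases (T.tile i ∩ T.tile j).eq_empty_or_nonempty with h | h
  · simp [h]
  obtain ⟨C, hfin, hC, -, hU⟩ := T.inter_tile i j hij h
  refine hfin.subset ?_
  rintro c ⟨hc, u, huc, hu⟩
  rw [← hU] at hu
  obtain ⟨d, hd, hud⟩ := hu
  rwa [edge_or_vertex_unique hc (hC d hd).symm huc hud]

/-! ### Tiles are regular closed sets -/

theorem subset_closure_interior (T : Tiling) (n : ℕ) :
    T.tile n ⊆ closure (interior (T.tile n)) := by
  intro u hu
  by_contra hcl
  set V : Set Plane := (closure (interior (T.tile n)))ᶜ with hV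
  have hVo : IsOpen V := isClosed_closure.isOpen_compl
  -- Near `u` the tile has no interior point, hence is covered by the other tiles.
  have hother : ∀ p ∈ V ∩ T.tile n, ∃ m, m ≠ n ∧ p ∈ T.tile m := by
    rintro p ⟨hpV, hpn⟩
    by_contra! hnone
    have hclosed : IsClosed (⋃ m : {m // m ≠ n}, T.tile m) :=
      (T.locallyFinite_tile.comp_injective Subtype.val_injective).isClosed_iUnion
        fun m => T.isClosed_tile m
    refine hpV (subset_closure (mem_interior.2 ⟨_, ?_, hclosed.isOpen_compl, ?_⟩))
    · intro x hx
      obtain ⟨m, hm⟩ := mem_iUnion.1 (T.iUnion_tile ▸ mem_univ x)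
      by_cases h : m = n
      · exact h ▸ hm
      · exact absurd (mem_iUnion.2 ⟨⟨m, h⟩, hm⟩) hx
    · intro hp
      obtain ⟨⟨m, h⟩, hm⟩ := mem_iUnion.1 hp
      exact hnone m h hm
  obtain ⟨h⟩ := T.tile_homeo n
  -- The trace of `V` on the disk contains a nonempty open subset of the plane.
  obtain ⟨O, hO, hOeq⟩ := isOpen_induced_iff.1
    ((hVo.preimage continuous_subtype_val).preimage h.symm.continuous)
  have hWne : (O ∩ Metric.ball (0 : Plane) 1).Nonempty := by
    have hmem : (h ⟨u, hu⟩ : Plane) ∈ closure (Metric.ball (0 : Plane) 1) := by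
      rw [closure_ball _ one_ne_zero]
      exact (h ⟨u, hu⟩).2
    refine mem_closure_iff.1 hmem O hO ?_
    change h ⟨u, hu⟩ ∈ Subtype.val ⁻¹' O
    rw [hOeq]
    simpa [hV] using hcl
  obtain ⟨e, he, heinj, hmem⟩ :=
    Plane.exists_continuous_injective_mem (hO.inter Metric.isOpen_ball) hWne
  have hcb : ∀ p, e p ∈ Metric.closedBall (0 : Plane) 1 := fun p =>
    Metric.ball_subset_closedBall (hmem p).2
  let G : Plane → Plane := fun p => h.symm ⟨e p, hcb p⟩
  have hGV : ∀ p, G p ∈ V ∩ T.tile n := by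
    intro p
    refine ⟨?_, (h.symm ⟨e p, hcb p⟩).2⟩
    have : (⟨e p, hcb p⟩ : Metric.closedBall (0 : Plane) 1) ∈ Subtype.val ⁻¹' O := (hmem p).1
    rw [hOeq] at this
    exact this
  refine Plane.false_of_injective_of_countable_cover
    (C := ⋃ m : {m // n ≠ m}, {c | (IsEdge T.tile c ∨ IsVertex T.tile c) ∧
      (c ∩ (T.tile n ∩ T.tile m)).Nonempty})
    (countable_iUnion fun m => (T.finite_edges_vertices_inter m.2).countable) ?_ ?_
    (G := G) ?_ ?_ ?_
  · intro c hc
    obtain ⟨m, hc, -⟩ := mem_iUnion.1 hc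
    rcases hc with hc | ⟨v, -, rfl⟩
    · exact isSigmaCompact_edge hc
    · exact isCompact_singleton.isSigmaCompact
  · intro c hc
    obtain ⟨m, hc, -⟩ := mem_iUnion.1 hc
    rcases hc with hc | ⟨v, -, rfl⟩
    · exact exists_continuous_injective_edge hc
    · exact ⟨fun _ => 0, continuous_const, fun _ _ _ => Subsingleton.elim _ _⟩
  · exact continuous_subtype_val.comp (h.symm.continuous.comp (he.subtype_mk hcb))
  · exact fun p p' hp => heinj (congrArg Subtype.val (h.symm.injective (Subtype.ext hp)))
  · intro p
    obtain ⟨m, hmn, hm⟩ := hother _ (hGV p)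
    have hn := (hGV p).2
    obtain ⟨C, -, hC, -, hU⟩ := T.inter_tile n m hmn.symm ⟨_, hn, hm⟩
    have hmem : G p ∈ ⋃₀ C := hU ▸ ⟨hn, hm⟩
    obtain ⟨c, hc, hpc⟩ := hmem
    exact ⟨c, mem_iUnion.2 ⟨⟨m, hmn.symm⟩, (hC c hc).symm, _, hpc, hn, hm⟩, hpc⟩

theorem closure_interior_tile (T : Tiling) (n : ℕ) :
    closure (interior (T.tile n)) = T.tile n :=
  (closure_minimal interior_subset (T.isClosed_tile n)).antisymm (T.subset_closure_interior n)

theorem interior_tile_nonempty (T : Tiling) (n : ℕ) : (interior (T.tile n)).Nonempty := by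
  rw [← closure_nonempty_iff, closure_interior_tile]
  exact (T.isConnected_tile n).nonempty

theorem eq_of_mem_interior_tile {u : Plane} {m n : ℕ} (hm : u ∈ interior (T.tile m))
    (hn : u ∈ T.tile n) : n = m := by
  by_contra h
  obtain ⟨p, hp⟩ := mem_closure_iff.1 (T.subset_closure_interior n hn) _ isOpen_interior hm
  exact notMem_empty p (T.interior_disjoint m n (Ne.symm h) ▸ hp)

/-! ### The cell decomposition -/

theorem exists_tiles_of_mem_edge_or_vertex {c : Set Plane}
    (hc : IsEdge T.tile c ∨ IsVertex T.tile c) {u : Plane} (hu : u ∈ c) :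
    ∃ i j, i ≠ j ∧ u ∈ T.tile i ∧ u ∈ T.tile j := by
  rcases hc with hc | ⟨v, ⟨i, j, k, hij, -, -, hi, hj, -⟩, rfl⟩
  · obtain ⟨i, j, hij, hi, hj⟩ := edge_exists_tiles hc
    exact ⟨i, j, hij, hi hu, hj hu⟩
  · obtain rfl := mem_singleton_iff.1 hu
    exact ⟨i, j, hij, hi, hj⟩

theorem disjoint_face_edge_or_vertex {c d : Set Plane} (hc : IsFace T.tile c)
    (hd : IsEdge T.tile d ∨ IsVertex T.tile d) : Disjoint c d := by
  obtain ⟨n, rfl⟩ := hc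
  rw [disjoint_left]
  intro u hu hud
  obtain ⟨i, j, hij, hi, hj⟩ := exists_tiles_of_mem_edge_or_vertex hd hud
  exact hij ((eq_of_mem_interior_tile hu hi).trans (eq_of_mem_interior_tile hu hj).symm)

theorem cell_unique {c d : T.DigitalVersion} {u : Plane} (hc : u ∈ c.1) (hd : u ∈ d.1) :
    c = d := by
  refine Subtype.ext ?_
  rcases c.2 with hcf | hce <;> rcases d.2 with hdf | hde
  · obtain ⟨m, hm⟩ := hcf
    obtain ⟨n, hn⟩ := hdf
    rw [hm] at hc
    rw [hn] at hd
    rw [hm, hn, eq_of_mem_interior_tile hc (interior_subset hd)]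
  · exact absurd hd (disjoint_left.1 (disjoint_face_edge_or_vertex hcf hde) hc)
  · exact absurd hc (disjoint_left.1 (disjoint_face_edge_or_vertex hdf hce) hd)
  · exact edge_or_vertex_unique hce hde hc hd

theorem cell_nonempty (c : T.DigitalVersion) : c.1.Nonempty := by
  rcases c with ⟨_, ⟨n, rfl⟩ | hc | ⟨v, -, rfl⟩⟩
  · exact T.interior_tile_nonempty n
  · exact edge_nonempty hc
  · exact singleton_nonempty v

theorem mem_q (T : Tiling) (u : Plane) : u ∈ (T.q u).1 := by
  by_cases hv : IsVertexPoint T.tile u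
  · have h : T.q u = ⟨{u}, Or.inr (Or.inr ⟨u, hv, rfl⟩)⟩ := dif_pos hv
    rw [h]
    exact mem_singleton u
  by_cases he : ∃ e, IsEdge T.tile e ∧ u ∈ e
  · have h : T.q u = ⟨he.choose, Or.inr (Or.inl he.choose_spec.1)⟩ :=
      (dif_neg hv).trans (dif_pos he)
    rw [h]
    exact he.choose_spec.2
  · have h : T.q u = ⟨(T.exists_face u hv he).choose,
        Or.inl (T.exists_face u hv he).choose_spec.1⟩ := (dif_neg hv).trans (dif_neg he)
    rw [h]
    exact (T.exists_face u hv he).choose_spec.2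

theorem q_eq_iff {u : Plane} {c : T.DigitalVersion} : T.q u = c ↔ u ∈ c.1 :=
  ⟨fun h => h ▸ T.mem_q u, fun h => cell_unique (T.mem_q u) h⟩

theorem locallyFinite_cells (T : Tiling) : LocallyFinite fun c : T.DigitalVersion => c.1 := by
  intro u
  obtain ⟨V, hV, hfin⟩ := T.locallyFinite_tile u
  refine ⟨V, hV, Finite.of_finite_image (f := Subtype.val) ?_ Subtype.val_injective.injOn⟩
  refine ((hfin.image fun n => interior (T.tile n)).union
    (hfin.biUnion fun i _ => hfin.biUnion fun j _ =>
      (?_ : {c | i ≠ j ∧ (IsEdge T.tile c ∨ IsVertex T.tile c) ∧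
        (c ∩ (T.tile i ∩ T.tile j)).Nonempty}.Finite))).subset ?_
  · by_cases hij : i = j
    · simp [hij]
    · exact (T.finite_edges_vertices_inter hij).subset fun c hc => hc.2
  · rintro _ ⟨c, ⟨p, hpc, hpV⟩, rfl⟩
    rcases c.2 with ⟨n, hn⟩ | hc
    · have hp : p ∈ c.1 := hpc
      rw [hn] at hp
      exact Or.inl ⟨n, ⟨p, interior_subset hp, hpV⟩, hn.symm⟩
    · obtain ⟨i, j, hij, hi, hj⟩ := exists_tiles_of_mem_edge_or_vertex hc hpc
      exact Or.inr (mem_biUnion ⟨p, hi, hpV⟩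
        (mem_biUnion ⟨p, hj, hpV⟩ ⟨hij, hc, p, hpc, hi, hj⟩))

/-- The frontier condition: a cell meeting the closure of a cell is contained in it. -/
theorem subset_closure_of_mem_closure {c d : T.DigitalVersion} {u : Plane} (hc : u ∈ c.1)
    (hd : u ∈ closure d.1) : c.1 ⊆ closure d.1 := by
  rcases c.2 with ⟨m, hm⟩ | hce | ⟨v, -, hcv⟩
  · rw [hm] at hc
    obtain ⟨p, hpm, hpd⟩ := mem_closure_iff.1 hd _ isOpen_interior hc
    rw [← hm] at hpm
    exact cell_unique hpm hpd ▸ subset_closure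
  · have huv := edge_not_isVertexPoint hce hc
    rcases d.2 with ⟨n, hn⟩ | hde | ⟨w, hw, hdw⟩
    · rw [hn, closure_interior_tile] at hd ⊢
      exact edge_subset_tile hce hc hd
    · rw [edge_unique hce hde hc (mem_edge_of_mem_closure hde hd huv)]
      exact subset_closure
    · rw [hdw, closure_singleton, mem_singleton_iff] at hd
      exact absurd (hd ▸ hw) huv
  · rw [hcv] at hc ⊢
    obtain rfl := mem_singleton_iff.1 hc
    exact singleton_subset_iff.2 hd

/-! ### Stars -/

/-- The open star of a cell `x`: the cells whose closures contain `x`. -/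
def star (T : Tiling) (x : T.DigitalVersion) : Set T.DigitalVersion := {d | x.1 ⊆ closure d.1}

theorem isOpen_star (x : T.DigitalVersion) : IsOpen (T.star x) := by
  rw [isOpen_coinduced, isOpen_iff_mem_nhds]
  intro u hu
  have hu : x.1 ⊆ closure (T.q u).1 := hu
  -- Points near `u` lie only in cells whose closures contain `u`.
  filter_upwards [T.locallyFinite_cells.closure.eventually_subset (fun _ => isClosed_closure) u]
    with y hy
  have huy : u ∈ closure (T.q y).1 := hy (subset_closure (T.mem_q y))
  exact hu.trans (closure_minimal (subset_closure_of_mem_closure (T.mem_q u) huy) isClosed_closure)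

theorem isLeast_star (x : T.DigitalVersion) :
    IsLeast {N : Set T.DigitalVersion | N ∈ 𝓝 x} (T.star x) := by
  refine ⟨(isOpen_star x).mem_nhds (subset_closure : x.1 ⊆ closure x.1), fun N hN d hd => ?_⟩
  obtain ⟨U, hUN, hU, hxU⟩ := mem_nhds_iff.1 hN
  obtain ⟨u, hu⟩ := cell_nonempty x
  have huU : u ∈ T.q ⁻¹' U := by rwa [mem_preimage, q_eq_iff.2 hu]
  obtain ⟨p, hpU, hpd⟩ := mem_closure_iff.1 (hd hu) _ (isOpen_coinduced.1 hU) huU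
  rw [mem_preimage, q_eq_iff.2 hpd] at hpU
  exact hUN hpU

theorem alexandrovDiscrete_digitalVersion (T : Tiling) : AlexandrovDiscrete T.DigitalVersion := by
  refine ⟨fun S hS => isOpen_iff_mem_nhds.2 fun x hx => ?_⟩
  refine Filter.mem_of_superset (isLeast_star x).1 (subset_sInter fun U hU => ?_)
  exact (isLeast_star x).2 ((hS U hU).mem_nhds (hx U hU))

theorem self_mem_star (x : T.DigitalVersion) : x ∈ T.star x := subset_closure (s := x.1)

theorem facesOf_subset_star (x : T.DigitalVersion) : T.facesOf x ⊆ T.star x := by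
  rintro f ⟨n, hf, hx⟩
  change x.1 ⊆ closure f.1
  rwa [hf, closure_interior_tile]

theorem mem_facesOf_of_mem_star {x d : T.DigitalVersion} (hd : d ∈ T.star x)
    (hf : IsFace T.tile d.1) : d ∈ T.facesOf x := by
  obtain ⟨n, hn⟩ := hf
  refine ⟨n, hn, ?_⟩
  rw [← closure_interior_tile, ← hn]
  exact hd

theorem eq_of_mem_star_of_isVertex {x d : T.DigitalVersion} (hd : d ∈ T.star x)
    (hv : IsVertex T.tile d.1) : d = x := by
  obtain ⟨v, -, hv⟩ := hv
  obtain ⟨u, hu⟩ := cell_nonempty x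
  have hud : u ∈ closure d.1 := hd hu
  rw [hv, closure_singleton, ← hv] at hud
  exact cell_unique hud hu

theorem star_eq_union (x : T.DigitalVersion) :
    T.star x = {x} ∪ T.edgesOf x ∪ T.facesOf x := by
  ext d
  constructor
  · intro hd
    rcases d.2 with hf | he | hv
    · exact Or.inr (mem_facesOf_of_mem_star hd hf)
    · exact Or.inl (Or.inr ⟨he, hd⟩)
    · exact Or.inl (Or.inl (eq_of_mem_star_of_isVertex hd hv))
  · rintro ((rfl | hd) | hd)
    · exact self_mem_star _
    · exact hd.2
    · exact facesOf_subset_star x hd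

theorem star_of_mem_edges {x : T.DigitalVersion} (hx : x ∈ T.edges) :
    T.star x = {x} ∪ T.facesOf x := by
  refine subset_antisymm (fun d hd => ?_) (union_subset (singleton_subset_iff.2 (self_mem_star x))
    (facesOf_subset_star x))
  rcases d.2 with hf | he | hv
  · exact Or.inr (mem_facesOf_of_mem_star hd hf)
  · obtain ⟨u, hu⟩ := cell_nonempty x
    exact Or.inl (cell_unique
      (mem_edge_of_mem_closure he (hd hu) (edge_not_isVertexPoint hx hu)) hu)
  · exact Or.inl (eq_of_mem_star_of_isVertex hd hv)

theorem star_of_mem_faces {x : T.DigitalVersion} (hx : x ∈ T.faces) : T.star x = {x} := by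
  refine subset_antisymm (fun d hd => ?_) (singleton_subset_iff.2 (self_mem_star x))
  obtain ⟨n, hn⟩ := hx
  obtain ⟨u, hu⟩ := cell_nonempty x
  have hxo : IsOpen x.1 := hn ▸ isOpen_interior
  obtain ⟨p, hpx, hpd⟩ := mem_closure_iff.1 (hd hu) _ hxo hu
  exact cell_unique hpd hpx

theorem ncard_facesOf_of_mem_edges {x : T.DigitalVersion} (hx : x ∈ T.edges) :
    (T.facesOf x).ncard = 2 := by
  obtain ⟨i, j, hij, hi, hj⟩ := edge_exists_tiles hx
  rw [ncard_eq_two]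
  refine ⟨⟨_, Or.inl ⟨i, rfl⟩⟩, ⟨_, Or.inl ⟨j, rfl⟩⟩, fun h => ?_, ?_⟩
  · have h : interior (T.tile i) = interior (T.tile j) := congrArg Subtype.val h
    obtain ⟨p, hp⟩ := T.interior_tile_nonempty i
    exact hij (eq_of_mem_interior_tile (h ▸ hp) (interior_subset hp))
  · ext f
    constructor
    · rintro ⟨n, hf, hn⟩
      obtain ⟨u, hu⟩ := cell_nonempty x
      rcases eq_or_eq_of_not_isVertexPoint (edge_not_isVertexPoint hx hu) hij (hi hu) (hj hu)
        (hn hu) with rfl | rfl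
      · exact Or.inl (Subtype.ext hf)
      · exact Or.inr (Subtype.ext hf)
    · rintro (rfl | rfl)
      · exact ⟨i, rfl, hi⟩
      · exact ⟨j, rfl, hj⟩

end Tiling

theorem theorem3p2 (T : Tiling) :
    AlexandrovDiscrete T.DigitalVersion ∧
    (∀ x ∈ T.vertices, IsLeast {N : Set T.DigitalVersion | N ∈ 𝓝 x}
      ({x} ∪ T.edgesOf x ∪ T.facesOf x)) ∧
    (∀ x ∈ T.edges, (T.facesOf x).ncard = 2 ∧
      IsLeast {N : Set T.DigitalVersion | N ∈ 𝓝 x} ({x} ∪ T.facesOf x)) ∧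
    (∀ x ∈ T.faces, IsLeast {N : Set T.DigitalVersion | N ∈ 𝓝 x} {x}) :=
  ⟨T.alexandrovDiscrete_digitalVersion,
    fun x _ => Tiling.star_eq_union x ▸ Tiling.isLeast_star x,
    fun x hx => ⟨Tiling.ncard_facesOf_of_mem_edges hx,
      Tiling.star_of_mem_edges hx ▸ Tiling.isLeast_star x⟩,
    fun x hx => Tiling.star_of_mem_faces hx ▸ Tiling.isLeast_star x⟩
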